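/- Let $R$ be a factorial integral domain with exactly one maximal ideal (quasilocal, not assumed Noetherian) and of Krull dimension $3$. Suppose that $R$ is a directed union of $3$-dimensional Noetherian domains, that is, $R=\bigcup_{i\in I}R_i$ for a family $(R_i)_{i\in I}$ of subrings of $R$, directed by inclusion, such that each $R_i$ is Noetherian of Krull dimension $3$. (Fujita's example of a three-dimensional factorial domain which is not catenarian is of this form.) Then $R$ is locally Jaffard: for every prime ideal $p$ of $R$ the localization $R_p$ is a finite-dimensional domain such that $$\dim\bigl(R_p[X_1,\dots,X_n]\bigr)=n+\dim(R_p)\qquad\text{for all } n\ge 1 .$$ -/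

import Mathlib

/-- A finite-dimensional integral domain `R` is *Jaffard* if
`dim R[X₁, …, Xₙ] = n + dim R` for every `n ≥ 1`. -/
structure IsJaffard (R : Type*) [CommRing R] : Prop where
  isDomain : IsDomain R
  finiteDimensional : FiniteRingKrullDim R
  ringKrullDim_mvPolynomial : ∀ n : ℕ, 1 ≤ n →
    ringKrullDim (MvPolynomial (Fin n) R) = (n : WithBot ℕ∞) + ringKrullDim R

/-- `R` is *locally Jaffard* if its localization at every prime ideal is a Jaffard domain. -/
def IsLocallyJaffard (R : Type*) [CommRing R] : Prop :=
  ∀ (p : Ideal R) [p.IsPrime], IsJaffard (Localization.AtPrime p)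

/-! The bound `n + dim R_p ≤ dim R_p[X₁, …, Xₙ]` is general. For the converse, strictness of a
finite chain of primes is witnessed by finitely many elements, so dimension bounds pass to directed
unions. Put `p_i = p ∩ A i`; Noetherianity gives `dim (A i)_{p_i}[X₁, …, Xₙ] = n + ht p_i`, so it
suffices that `ht p_i ≤ ht p` for all large `i`. If `ht p ≤ 1`, factoriality makes `R_p` Noetherian
and no approximation is needed. If `p` is maximal, `ht p = 3` bounds every `p_i`. Otherwise `ht p ≥
2`, and an element of the maximal ideal outside `p` keeps `p_i` strictly below another prime, so `ht
p_i ≤ 2`. -/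

/-- If every finite subset of `S` lies in the image of a ring of Krull dimension at most `d`,
then `S` has Krull dimension at most `d`. -/
theorem ringKrullDim_le_of_forall_finset {S : Type*} [CommRing S] {d : ℕ}
    (h : ∀ T : Finset S, ∃ (B : Type*) (_ : CommRing B) (f : B →+* S),
      (T : Set S) ⊆ Set.range f ∧ ringKrullDim B ≤ d) :
    ringKrullDim S ≤ d := by
  classical
  refine iSup_le fun l => ?_
  have hex : ∀ k : Fin l.length,
      ∃ x, x ∈ (l k.succ).asIdeal ∧ x ∉ (l k.castSucc).asIdeal := fun k =>
    SetLike.exists_of_lt (l.step k)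
  choose x hx hx' using hex
  -- Once the witnesses `x k` lift to `B`, contraction along `f` keeps every inclusion strict.
  obtain ⟨B, _, f, hT, hB⟩ := h (Finset.univ.image x)
  have hmem : ∀ k, ∃ b, f b = x k := fun k => hT (by simp)
  choose b hb using hmem
  let l' : LTSeries (PrimeSpectrum B) :=
    { length := l.length
      toFun := fun k => PrimeSpectrum.comap f (l k)
      step := fun k => by
        refine SetLike.lt_iff_le_and_exists.mpr
          ⟨Ideal.comap_mono (l.step k).le, b k, ?_, ?_⟩
        · change f (b k) ∈ (l k.succ).asIdeal
          rw [hb]; exact hx k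
        · change ¬ f (b k) ∈ (l k.castSucc).asIdeal
          rw [hb]; exact hx' k }
  exact (Order.LTSeries.length_le_krullDim l').trans hB

/-- If every finite subset of `S` lies in the image of a Noetherian ring of Krull dimension at
most `d`, then the polynomial ring in `n` variables over `S` has Krull dimension at most
`n + d`. -/
theorem ringKrullDim_mvPolynomial_le_of_forall_finset {S : Type*} [CommRing S] {d : ℕ} (n : ℕ)
    (h : ∀ T : Finset S, ∃ (B : Type*) (_ : CommRing B) (f : B →+* S),
      (T : Set S) ⊆ Set.range f ∧ IsNoetherianRing B ∧ ringKrullDim B ≤ d) :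
    ringKrullDim (MvPolynomial (Fin n) S) ≤ (n : WithBot ℕ∞) + d := by
  classical
  have key : ringKrullDim (MvPolynomial (Fin n) S) ≤ ((n + d : ℕ) : WithBot ℕ∞) := by
    refine ringKrullDim_le_of_forall_finset fun T => ?_
    obtain ⟨B, _, f, hT, _, hB⟩ := h (T.biUnion fun q => q.coeffs)
    refine ⟨MvPolynomial (Fin n) B, inferInstance, MvPolynomial.map f, fun q hq => ?_, ?_⟩
    · refine MvPolynomial.mem_range_map_iff_coeffs_subset.mpr fun c hc => hT ?_
      exact Finset.mem_coe.mpr (Finset.mem_biUnion.mpr ⟨q, hq, hc⟩)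
    · rw [MvPolynomial.ringKrullDim_of_isNoetherianRing, Nat.card_eq_fintype_card, Fintype.card_fin,
        Nat.cast_add, add_comm]
      gcongr
  simpa using key

/-- A Noetherian domain of finite Krull dimension is a Jaffard domain. -/
theorem IsJaffard.of_isNoetherianRing (S : Type*) [CommRing S] [IsDomain S] [IsNoetherianRing S]
    [FiniteRingKrullDim S] : IsJaffard S where
  isDomain := inferInstance
  finiteDimensional := inferInstance
  ringKrullDim_mvPolynomial n _ := by
    rw [MvPolynomial.ringKrullDim_of_isNoetherianRing, Nat.card_eq_fintype_card, Fintype.card_fin,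
      add_comm]

/-- In a directed union of subrings, every finite set lies in one of them, which can be chosen
to contain a given one. -/
theorem Subring.exists_ge_of_finset_of_directed {R ι : Type*} [CommRing R] {A : ι → Subring R}
    (hdir : Directed (· ≤ ·) A) (hunion : (⋃ i, (A i : Set R)) = Set.univ) (j : ι)
    (T : Finset R) : ∃ i, A j ≤ A i ∧ (T : Set R) ⊆ A i := by
  classical
  induction T using Finset.induction_on with
  | empty => exact ⟨j, le_rfl, by simp⟩
  | insert a T _ ih =>
    obtain ⟨i, hji, hi⟩ := ih
    obtain ⟨k, hk⟩ := Set.mem_iUnion.mp (hunion ▸ Set.mem_univ a : a ∈ ⋃ i, (A i : Set R))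
    obtain ⟨l, hil, hkl⟩ := hdir i k
    refine ⟨l, hji.trans hil, ?_⟩
    rw [Finset.coe_insert, Set.insert_subset_iff]
    exact ⟨hkl hk, hi.trans hil⟩

/-- Let `R` be a directed union of Noetherian subrings `A i`. If the contractions of `p` to all
`A i` containing a fixed `A j` have height at most `e`, then the polynomial ring in `n` variables
over `R_p` has dimension at most `n + e`. -/
theorem ringKrullDim_mvPolynomial_localization_le_of_directed {R ι : Type*} [CommRing R]
    {A : ι → Subring R} (hdir : Directed (· ≤ ·) A)
    (hunion : (⋃ i, (A i : Set R)) = Set.univ) (hnoeth : ∀ i, IsNoetherianRing (A i))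
    (p : Ideal R) [p.IsPrime] {e : ℕ} (j : ι)
    (he : ∀ i, A j ≤ A i → (p.comap (A i).subtype).height ≤ e) (n : ℕ) :
    ringKrullDim (MvPolynomial (Fin n) (Localization.AtPrime p)) ≤ (n : WithBot ℕ∞) + e := by
  classical
  refine ringKrullDim_mvPolynomial_le_of_forall_finset n fun T => ?_
  have hfrac : ∀ t : Localization.AtPrime p, ∃ (a : R) (s : p.primeCompl),
      IsLocalization.mk' (Localization.AtPrime p) a s = t :=
    fun t => IsLocalization.exists_mk'_eq p.primeCompl t
  choose a s has using hfrac
  -- One `A i` contains all chosen numerators and denominators of `T`.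
  obtain ⟨i, hji, hi⟩ := Subring.exists_ge_of_finset_of_directed hdir hunion j
    (T.image a ∪ T.image fun t => (s t : R))
  have := hnoeth i
  refine ⟨Localization.AtPrime (p.comap (A i).subtype), inferInstance,
    Localization.localRingHom _ p (A i).subtype rfl, fun t ht => ?_,
    IsLocalization.isNoetherianRing (p.comap (A i).subtype).primeCompl _ inferInstance, ?_⟩
  · have ha : a t ∈ A i := hi (by
      simp only [Finset.coe_union, Finset.coe_image]
      exact Or.inl ⟨t, ht, rfl⟩)
    have hs : (s t : R) ∈ A i := hi (by
      simp only [Finset.coe_union, Finset.coe_image]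
      exact Or.inr ⟨t, ht, rfl⟩)
    refine ⟨IsLocalization.mk' _ (⟨a t, ha⟩ : A i)
      (⟨⟨s t, hs⟩, (s t).2⟩ : (p.comap (A i).subtype).primeCompl), ?_⟩
    rw [Localization.localRingHom_mk']
    exact has t
  · rw [IsLocalization.AtPrime.ringKrullDim_eq_height (p.comap (A i).subtype)]
    exact_mod_cast he i hji

/-- A prime of height at most one of a unique factorization domain is principal. -/
theorem Ideal.isPrincipal_of_height_le_one {R : Type*} [CommRing R] [IsDomain R]
    [UniqueFactorizationMonoid R] (p : Ideal R) [p.IsPrime] (hp : p.height ≤ 1) :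
    p.IsPrincipal := by
  rcases eq_or_ne p ⊥ with rfl | hne
  · infer_instance
  obtain ⟨x, hxp, hx⟩ := Ideal.IsPrime.exists_mem_prime_of_ne_bot ‹p.IsPrime› hne
  have hprime : (Ideal.span {x}).IsPrime := (Ideal.span_singleton_prime hx.ne_zero).mpr hx
  refine ⟨x, ?_⟩
  by_contra hcon
  have hlt : Ideal.span {x} < p :=
    lt_of_le_of_ne ((Ideal.span_singleton_le_iff_mem p).mpr hxp) fun h => hcon h.symm
  have h1 := (Ideal.height_add_one_le_of_lt_of_isPrime hlt).trans hp
  have h2 : (1 : ℕ∞) ≤ (Ideal.span {x}).height :=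
    Ideal.one_le_height_span_singleton_of_mem_nonZeroDivisors
      (mem_nonZeroDivisors_of_ne_zero hx.ne_zero)
  have h3 : ((1 + 1 : ℕ) : ℕ∞) ≤ ((1 : ℕ) : ℕ∞) := by
    push_cast
    exact (add_le_add_left h2 1).trans h1
  exact absurd (Nat.cast_le.mp h3) (by norm_num)

/-- The localization of a unique factorization domain at a prime of height at most one is
Noetherian. -/
theorem isNoetherianRing_localization_of_height_le_one {R : Type*} [CommRing R] [IsDomain R]
    [UniqueFactorizationMonoid R] (p : Ideal R) [p.IsPrime] (hp : p.height ≤ 1) :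
    IsNoetherianRing (Localization.AtPrime p) := by
  -- Cohen's theorem: only primes need be finitely generated, and each is extended from a prime of
  -- `R` inside `p`, hence principal.
  refine IsNoetherianRing.of_prime fun P hP => ?_
  have hle : P.under R ≤ p :=
    (Ideal.comap_mono (IsLocalRing.le_maximalIdeal hP.ne_top)).trans
      (Localization.AtPrime.under_maximalIdeal (I := p)).le
  have : (P.under R).IsPrincipal :=
    Ideal.isPrincipal_of_height_le_one _ ((Ideal.height_mono hle).trans hp)
  rw [← IsLocalization.map_under p.primeCompl (Localization.AtPrime p) P]
  exact Ideal.FG.map (Submodule.IsPrincipal.fg this) _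

theorem mainTheorem7 {R : Type*} [CommRing R] [IsDomain R]
    [UniqueFactorizationMonoid R] [IsLocalRing R] (hdim : ringKrullDim R = 3)
    {ι : Type*} (A : ι → Subring R) (hdir : Directed (· ≤ ·) A)
    (hunion : (⋃ i, (A i : Set R)) = Set.univ)
    (hnoeth : ∀ i, IsNoetherianRing (A i))
    (hAdim : ∀ i, ringKrullDim (A i) = 3) :
    IsLocallyJaffard R := by
  intro p _
  have hloc := IsLocalization.AtPrime.ringKrullDim_eq_height p (Localization.AtPrime p)
  have hp3 : p.height ≤ 3 := by
    have h : (p.height : WithBot ℕ∞) ≤ 3 := hdim ▸ Ideal.height_le_ringKrullDim_of_isPrime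
    exact WithBot.coe_le_coe.mp h
  have hdom : IsDomain (Localization.AtPrime p) :=
    IsLocalization.isDomain_localization p.primeCompl_le_nonZeroDivisors
  have hfin : FiniteRingKrullDim (Localization.AtPrime p) := by
    refine finiteRingKrullDim_iff_ne_bot_and_top.mpr ⟨by simp [hloc], ?_⟩
    rw [hloc]
    intro h
    have h' : p.height = ⊤ := by exact_mod_cast h
    rw [h'] at hp3
    exact absurd hp3 (by decide)
  rcases le_or_gt p.height 1 with hp1 | hp1
  · have := isNoetherianRing_localization_of_height_le_one p hp1
    exact IsJaffard.of_isNoetherianRing _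
  obtain ⟨e, he⟩ := ENat.ne_top_iff_exists.mp
    (ne_top_of_le_ne_top (by decide : (3 : ℕ∞) ≠ ⊤) hp3)
  suffices h : ∃ j, ∀ i, A j ≤ A i → (p.comap (A i).subtype).height ≤ e by
    obtain ⟨j, hj⟩ := h
    refine ⟨hdom, hfin, fun n _ => le_antisymm ?_ ?_⟩
    · rw [hloc, ← he]
      exact ringKrullDim_mvPolynomial_localization_le_of_directed hdir hunion hnoeth p j hj n
    · have h := ringKrullDim_add_natCard_le_ringKrullDim_mvPolynomial
        (R := Localization.AtPrime p) (Fin n)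
      rwa [Nat.card_eq_fintype_card, Fintype.card_fin, add_comm] at h
  have hbound : ∀ i (q : Ideal (A i)) [q.IsPrime], q.height ≤ 3 := fun i q _ => by
    have h : (q.height : WithBot ℕ∞) ≤ 3 := hAdim i ▸ Ideal.height_le_ringKrullDim_of_isPrime
    exact WithBot.coe_le_coe.mp h
  rw [← he] at hp1 hp3
  have he1 : 1 < e := by exact_mod_cast hp1
  rcases eq_or_ne p (IsLocalRing.maximalIdeal R) with hpm | hpm
  · obtain ⟨j, -⟩ := Set.mem_iUnion.mp
      (hunion ▸ Set.mem_univ (0 : R) : (0 : R) ∈ ⋃ i, (A i : Set R))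
    have h3 : (p.height : WithBot ℕ∞) = 3 := by
      rw [hpm, IsLocalRing.maximalIdeal_height_eq_ringKrullDim, hdim]
    have h3' : p.height = 3 := WithBot.coe_inj.mp h3
    exact ⟨j, fun i _ => he ▸ h3' ▸ hbound i _⟩
  · have hlt : p < IsLocalRing.maximalIdeal R :=
      lt_of_le_of_ne (IsLocalRing.le_maximalIdeal (Ideal.IsPrime.ne_top ‹_›)) hpm
    -- In every `A i` containing `x`, the contractions of `p` and of the maximal ideal stay
    -- distinct.
    obtain ⟨x, hxm, hxp⟩ := SetLike.exists_of_lt hlt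
    obtain ⟨j, hj⟩ := Set.mem_iUnion.mp (hunion ▸ Set.mem_univ x : x ∈ ⋃ i, (A i : Set R))
    refine ⟨j, fun i hji => ?_⟩
    have hlt' : p.comap (A i).subtype < (IsLocalRing.maximalIdeal R).comap (A i).subtype :=
      SetLike.lt_iff_le_and_exists.mpr ⟨Ideal.comap_mono hlt.le, ⟨x, hji hj⟩, hxm, hxp⟩
    have h1 := (Ideal.height_add_one_le_of_lt_of_isPrime hlt').trans (hbound i _)
    have h2 : (p.comap (A i).subtype).height ≤ 2 :=
      (ENat.add_le_add_iff_right (by decide : (1 : ℕ∞) ≠ ⊤)).mp (h1.trans (by norm_num))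
    exact h2.trans (by exact_mod_cast he1)
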